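/- An inverse monoid is a monoid $M$ in which every $a$ has a unique $a^{-1}$ with $aa^{-1}a=a$ and $a^{-1}aa^{-1}=a^{-1}$. Its natural partial order is given by $a\le b$ iff $a=eb$ for some idempotent $e$, and $\sigma$ denotes its least group congruence. $M$ is finite-above if $\{n\in M: n\ge m\}$ is finite for every $m\in M$; it is $E$-unitary if every element above an idempotent is idempotent; it is $F$-inverse if every $\sigma$-class has a greatest element with respect to $\le$. An $F$-inverse cover of $M$ is an $F$-inverse monoid $F$ together with a surjective homomorphism $\varphi\colon F\to M$ that is injective on idempotents. It is a cover via a group $N$ if $N$ is (isomorphic to) the kernel of the surjective group homomorphism $F/\sigma\to M/\sigma$ induced by $\varphi$, and via a class $\mathbf D$ of groups if this kernel belongs to $\mathbf D$. A group variety is the class of all groups satisfying a given set of group identities; it is non-trivial if it contains a group with more than one element. **Proposition.** Let $M$ be a finite-above $E$-unitary inverse monoid with $|M/\sigma|\le 2$. Then, for every non-trivial group variety $\mathbf U$, $M$ has an $F$-inverse cover via $\mathbf U$. In particular, for every prime $p$, $M$ has an $F$-inverse cover via an elementary Abelian $p$-group (that is, an Abelian group, possibly infinite or trivial, in which $x^p=1$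 for all $x$). -/

import Mathlib

universe u v

/-- An inverse monoid: every `a` has exactly one `b` with `a b a = a` and `b a b = b`,
namely `b = a⁻¹`. -/
class InverseMonoid (M : Type*) extends Monoid M, Inv M where
  mul_inv_mul_self : ∀ a : M, a * a⁻¹ * a = a
  inv_mul_mul_inv : ∀ a : M, a⁻¹ * a * a⁻¹ = a⁻¹
  inv_unique : ∀ a b : M, a * b * a = a → b * a * b = b → b = a⁻¹

namespace InverseMonoid

/-- The natural partial order: `a ≤ b` iff `a = e b` for some idempotent `e`. -/
def NatLE {M : Type*} [InverseMonoid M] (a b : M) : Prop :=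
  ∃ e : M, IsIdempotentElem e ∧ a = e * b

/-- A congruence is a group congruence if its quotient monoid is a group. -/
def IsGroupCon {M : Type*} [Monoid M] (c : Con M) : Prop :=
  ∀ x : c.Quotient, IsUnit x

/-- The least group congruence `σ`, as the intersection of all group congruences
(which is again one: see `isGroupCon_sigma`). -/
def sigma (M : Type*) [InverseMonoid M] : Con M :=
  sInf {c : Con M | IsGroupCon c}

theorem isIdempotentElem_mul_inv {M : Type*} [InverseMonoid M] (a : M) :
    IsIdempotentElem (a * a⁻¹) := by
  show a * a⁻¹ * (a * a⁻¹) = a * a⁻¹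
  rw [← mul_assoc, mul_inv_mul_self]

theorem isIdempotentElem_inv_mul {M : Type*} [InverseMonoid M] (a : M) :
    IsIdempotentElem (a⁻¹ * a) := by
  show a⁻¹ * a * (a⁻¹ * a) = a⁻¹ * a
  rw [← mul_assoc, inv_mul_mul_inv]

theorem IsGroupCon.rel_one {M : Type*} [Monoid M] {c : Con M} (hc : IsGroupCon c) {e : M}
    (he : IsIdempotentElem e) : c e 1 := by
  have h : (e : c.Quotient) * e = e * 1 := by
    rw [mul_one, ← Con.coe_mul, he.eq]
  exact (Con.eq c).1 ((hc e).mul_left_cancel h)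

theorem sigma_rel_one {M : Type*} [InverseMonoid M] {e : M} (he : IsIdempotentElem e) :
    sigma M e 1 :=
  fun _ hc => IsGroupCon.rel_one hc he

theorem isGroupCon_of_rel_one {M : Type*} [InverseMonoid M] {c : Con M}
    (h : ∀ e : M, IsIdempotentElem e → c e 1) : IsGroupCon c := by
  intro x
  induction x using Con.induction_on with
  | H a =>
    refine ⟨⟨(a : c.Quotient), ((a⁻¹ : M) : c.Quotient), ?_, ?_⟩, rfl⟩
    · exact (Con.eq c).2 (h _ (isIdempotentElem_mul_inv a))
    · exact (Con.eq c).2 (h _ (isIdempotentElem_inv_mul a))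

theorem isGroupCon_sigma (M : Type*) [InverseMonoid M] : IsGroupCon (sigma M) :=
  isGroupCon_of_rel_one fun _ he => sigma_rel_one he

/-- The greatest group homomorphic image `M / σ`. -/
abbrev GroupImage (M : Type*) [InverseMonoid M] : Type _ := (sigma M).Quotient

noncomputable instance (M : Type*) [InverseMonoid M] : Group (GroupImage M) :=
  groupOfIsUnit (isGroupCon_sigma M)

theorem sigma_le_ker {F M : Type*} [InverseMonoid F] [InverseMonoid M] (φ : F →* M) :
    sigma F ≤ Con.ker ((sigma M).mk'.comp φ) := by
  refine sInf_le (isGroupCon_of_rel_one fun e he => ?_)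
  rw [Con.ker_rel, map_one]
  exact (Con.eq (sigma M)).2 (sigma_rel_one (he.map φ))

/-- The group homomorphism `F / σ → M / σ` induced by a homomorphism `φ : F → M`,
sending the class of `x` to the class of `φ x`. -/
noncomputable def groupImageMap {F M : Type*} [InverseMonoid F] [InverseMonoid M] (φ : F →* M) :
    GroupImage F →* GroupImage M :=
  (sigma F).lift ((sigma M).mk'.comp φ) (sigma_le_ker φ)

/-- `M` is finite-above: every principal filter of the natural partial order is finite. -/
def IsFiniteAbove (M : Type*) [InverseMonoid M] : Prop :=
  ∀ m : M, {n : M | NatLE m n}.Finite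

/-- `M` is `E`-unitary: every element above an idempotent is an idempotent. -/
def IsEUnitary (M : Type*) [InverseMonoid M] : Prop :=
  ∀ e a : M, IsIdempotentElem e → NatLE e a → IsIdempotentElem a

/-- `M` is `F`-inverse: every `σ`-class has a greatest element. -/
def IsFInverse (M : Type*) [InverseMonoid M] : Prop :=
  ∀ a : M, ∃ m : M, sigma M m a ∧ ∀ b : M, sigma M b a → NatLE b m

/-- `φ : F → M` makes `F` an `F`-inverse cover of `M`: `F` is `F`-inverse, and `φ` is a surjective
idempotent-separating homomorphism. -/
structure IsFInverseCover {F M : Type*} [InverseMonoid F] [InverseMonoid M] (φ : F →* M) :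
    Prop where
  fInverse : IsFInverse F
  surjective : Function.Surjective φ
  idempotentSeparating : Set.InjOn φ {e : F | IsIdempotentElem e}

/-- `M` has an `F`-inverse cover via the class `D` of groups: there is an `F`-inverse cover
`φ : F → M` such that `F / σ` is an extension of a member of `D` by `M / σ`, i.e. the kernel
of the induced surjection `F / σ → M / σ` is in `D`. -/
def HasFInverseCoverVia (M : Type u) [InverseMonoid M]
    (D : (N : Type u) → [Group N] → Prop) : Prop :=
  ∃ (F : Type u) (_ : InverseMonoid F) (φ : F →* M),
    IsFInverseCover φ ∧ D (groupImageMap φ).ker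

end InverseMonoid

/-- A group variety, given by a set of laws `w = 1`, where `w` is a group word in the variables
`x₀, x₁, …`. -/
structure GroupVariety where
  laws : Set (FreeGroup ℕ)

/-- `N` belongs to the variety: every law holds under every assignment of the variables. -/
def GroupVariety.Mem (U : GroupVariety) (N : Type*) [Group N] : Prop :=
  ∀ w ∈ U.laws, ∀ f : ℕ → N, FreeGroup.lift f w = 1

/-- The variety contains a group with more than one element. -/
def GroupVariety.IsNontrivial (U : GroupVariety) : Prop :=
  ∃ (N : Type v) (_ : Group N), Nontrivial N ∧ U.Mem N

/-- An elementary Abelian `p`-group (of arbitrary, possibly infinite, rank). -/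
def IsElementaryAbelianGroup (p : ℕ) (N : Type*) [Group N] : Prop :=
  (∀ a b : N, a * b = b * a) ∧ ∀ a : N, a ^ p = 1

/-! Since `M` is `E`-unitary, its idempotents form one `σ`-class, so with at most two classes a
product is idempotent exactly when its factors agree in being so. The cover is built inside a
semidirect product of finitely supported functions `M →₀ R` with `M`, where non-idempotents act by
negation combined with inversion of the argument. It consists of the pairs `(m, v)` in which `v` has
coefficient sum 0 or 1 according to the parity of `m` and lives on non-idempotents `y` with `m m⁻¹ ≤
y y⁻¹`. Two such pairs are `σ`-related iff their labels agree (`sigma_iff`), and each label has a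
greatest carrier (`Labels.exists_greatest`), so the cover is `F`-inverse. On the kernel of the
induced map the action is trivial, so the kernel embeds in `M →₀ R`. A non-trivial variety contains
some `ZMod p`, hence this kernel for `R = ZMod p`. -/

namespace InverseMonoid

/-! ### Idempotents, the natural order and `σ`. -/

section Basic

variable {M : Type*} [InverseMonoid M]

theorem inv_eq_self_of_isIdempotentElem {e : M} (he : IsIdempotentElem e) : e⁻¹ = e :=
  (inv_unique e e (by rw [he.eq, he.eq]) (by rw [he.eq, he.eq])).symm

theorem inv_inv_eq (a : M) : a⁻¹⁻¹ = a :=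
  (inv_unique a⁻¹ a (inv_mul_mul_inv a) (mul_inv_mul_self a)).symm

/-- In an inverse monoid the product of two idempotents is idempotent. -/
theorem isIdempotentElem_mul {e f : M} (he : IsIdempotentElem e) (hf : IsIdempotentElem f) :
    IsIdempotentElem (e * f) := by
  have he' : ∀ z : M, e * (e * z) = e * z := fun z => by rw [← mul_assoc, he.eq]
  have hf' : ∀ z : M, f * (f * z) = f * z := fun z => by rw [← mul_assoc, hf.eq]
  set x := (e * f)⁻¹ with hx
  have h1 : e * (f * (x * (e * f))) = e * f := by
    simpa only [mul_assoc] using mul_inv_mul_self (e * f)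
  have h2 : x * (e * (f * x)) = x := by
    simpa only [mul_assoc] using inv_mul_mul_inv (e * f)
  have h2' : ∀ z : M, x * (e * (f * (x * z))) = x * z := fun z => by
    rw [← mul_assoc f, ← mul_assoc e, ← mul_assoc x, h2]
  -- `f x e` is also an inverse of `e f`, so uniqueness absorbs `f` and `e` into `x`; this makes `x`
  -- idempotent, hence equal to its inverse `e f`.
  have h3 : f * x * e = x := by
    refine inv_unique (e * f) (f * x * e) ?_ ?_
    · simp only [mul_assoc, he', hf', h1]
    · simp only [mul_assoc, he', hf', h2']
  have hxi : IsIdempotentElem x := by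
    show x * x = x
    calc x * x = f * x * e * (f * x * e) := by rw [h3]
      _ = f * (x * (e * (f * (x * e)))) := by simp only [mul_assoc]
      _ = f * x * e := by rw [h2', mul_assoc]
      _ = x := h3
  have : e * f = x := by
    rw [← inv_inv_eq (e * f), ← hx, inv_eq_self_of_isIdempotentElem hxi]
  rw [this]
  exact hxi

theorem isIdempotentElem_mul_comm {e f : M} (he : IsIdempotentElem e)
    (hf : IsIdempotentElem f) : e * f = f * e := by
  have hef := isIdempotentElem_mul he hf
  have hfe := isIdempotentElem_mul hf he
  have he' : ∀ z : M, e * (e * z) = e * z := fun z => by rw [← mul_assoc, he.eq]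
  have hf' : ∀ z : M, f * (f * z) = f * z := fun z => by rw [← mul_assoc, hf.eq]
  have h1 : e * (f * (e * f)) = e * f := by simpa only [mul_assoc] using hef.eq
  have h2 : f * (e * (f * e)) = f * e := by simpa only [mul_assoc] using hfe.eq
  have h := inv_unique (e * f) (f * e) (by simp only [mul_assoc, he', hf', h1])
    (by simp only [mul_assoc, he', hf', h2])
  rw [h, inv_eq_self_of_isIdempotentElem hef]

theorem mul_idempotent_eq (a : M) {e : M} (he : IsIdempotentElem e) :
    a * e = a * e * a⁻¹ * a := by
  calc a * e = a * a⁻¹ * a * e := by rw [mul_inv_mul_self]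
    _ = a * ((a⁻¹ * a) * e) := by simp only [mul_assoc]
    _ = a * (e * (a⁻¹ * a)) := by
        rw [isIdempotentElem_mul_comm (isIdempotentElem_inv_mul a) he]
    _ = a * e * a⁻¹ * a := by simp only [mul_assoc]

theorem isIdempotentElem_conj (a : M) {e : M} (he : IsIdempotentElem e) :
    IsIdempotentElem (a * e * a⁻¹) := by
  show a * e * a⁻¹ * (a * e * a⁻¹) = a * e * a⁻¹
  calc a * e * a⁻¹ * (a * e * a⁻¹) = a * e * a⁻¹ * a * (e * a⁻¹) := by simp only [mul_assoc]
    _ = a * (e * e) * a⁻¹ := by rw [← mul_idempotent_eq a he]; simp only [mul_assoc]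
    _ = a * e * a⁻¹ := by rw [he.eq]

theorem natLE_mul_idempotent_mul (a b : M) {e : M} (he : IsIdempotentElem e) :
    NatLE (a * e * b) (a * b) :=
  ⟨a * e * a⁻¹, isIdempotentElem_conj a he, by
    rw [← mul_assoc, ← mul_idempotent_eq a he]⟩

/-- The syntactic congruence of the set of idempotents. -/
def idempotentSyntacticCon (M : Type*) [InverseMonoid M] : Con M where
  r a b := ∀ x y : M, IsIdempotentElem (x * a * y) ↔ IsIdempotentElem (x * b * y)
  iseqv := ⟨fun _ _ _ => Iff.rfl, fun h x y => (h x y).symm,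
    fun h h' x y => (h x y).trans (h' x y)⟩
  mul' := by
    intro a b c d hab hcd x y
    have h1 := hab x (c * y)
    have h2 := hcd (x * b) y
    simp only [mul_assoc] at h1 h2 ⊢
    exact h1.trans h2

/-- The syntactic congruence of the idempotents is a group congruence: `x e y` lies below `x y`, so
`E`-unitarity lets `e` be deleted, and it can be inserted because idempotents are closed under
products. As `σ` is the least such congruence, the context `x = y = 1` suffices. -/
theorem sigma_rel_one_iff (hM : IsEUnitary M) {a : M} :
    sigma M a 1 ↔ IsIdempotentElem a := by
  refine ⟨fun h => ?_, sigma_rel_one⟩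
  have hc : IsGroupCon (idempotentSyntacticCon M) := by
    refine isGroupCon_of_rel_one fun e he x y => ?_
    rw [mul_one]
    refine ⟨fun hi => hM _ _ hi (natLE_mul_idempotent_mul x y he), fun hi => ?_⟩
    obtain ⟨f, hf, h⟩ := natLE_mul_idempotent_mul x y he
    rw [h]
    exact isIdempotentElem_mul hf hi
  have := (h (idempotentSyntacticCon M) hc : ∀ x y : M, _) 1 1
  simp only [one_mul, mul_one] at this
  exact this.2 .one

theorem sigma_of_natLE {a b : M} (h : NatLE a b) : sigma M a b := by
  obtain ⟨e, he, rfl⟩ := h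
  simpa using (sigma M).mul (sigma_rel_one he) ((sigma M).refl b)

end Basic

/-! ### Labels and the twisted action. -/

section Labels

variable {M : Type*} [InverseMonoid M]

/-- The witness is the product of the `y y⁻¹`, their meet; it bounds every element that can carry a
label with support `s`. -/
theorem exists_idempotent_forall_mul_inv_mul (s : Finset M) :
    ∃ e : M, IsIdempotentElem e ∧ (∀ y ∈ s, y * y⁻¹ * e = e) ∧
      ∀ n : M, (∀ y ∈ s, y * y⁻¹ * n = n) → e * n = n := by
  classical
  induction s using Finset.induction_on with
  | empty => exact ⟨1, .one, by simp, by simp⟩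
  | insert z s _ ih =>
    obtain ⟨e, he, h1, h2⟩ := ih
    have hz := isIdempotentElem_mul_inv z
    refine ⟨z * z⁻¹ * e, isIdempotentElem_mul hz he, ?_, ?_⟩
    · intro y hy
      rcases Finset.mem_insert.1 hy with rfl | hy
      · rw [← mul_assoc, hz.eq]
      · rw [← mul_assoc, isIdempotentElem_mul_comm (isIdempotentElem_mul_inv y) hz, mul_assoc,
          h1 y hy]
    · intro n hn
      rw [mul_assoc, h2 n fun y hy => hn y (Finset.mem_insert_of_mem hy),
        hn z (Finset.mem_insert_self _ _)]

variable {R : Type*} [CommRing R]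

open Classical in
/-- The action of `M` on finitely supported functions on `M`: idempotents act trivially, and the
other elements act by `v ↦ (y ↦ -v y⁻¹)`. -/
noncomputable def twist (m : M) : (M →₀ R) →+ (M →₀ R) :=
  if IsIdempotentElem m then AddMonoidHom.id _ else
    -(Finsupp.mapDomain.addMonoidHom Inv.inv : (M →₀ R) →+ (M →₀ R))

theorem twist_congr {m n : M} (h : IsIdempotentElem m ↔ IsIdempotentElem n) :
    (twist m : (M →₀ R) →+ (M →₀ R)) = twist n := by
  classical
  simp only [twist, h]

theorem twist_of_idempotent {m : M} (hm : IsIdempotentElem m) (v : M →₀ R) : twist m v = v := by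
  simp [twist, hm]

theorem inv_injective_of_inverseMonoid : Function.Injective (Inv.inv : M → M) :=
  Function.LeftInverse.injective inv_inv_eq

theorem twist_apply_of_not_idempotent {m : M} (hm : ¬ IsIdempotentElem m) (v : M →₀ R) (y : M) :
    twist m v y = -v y⁻¹ := by
  have := Finsupp.mapDomain_apply (inv_injective_of_inverseMonoid (M := M)) v y⁻¹
  rw [inv_inv_eq] at this
  simp [twist, hm, this]

/-- The sum of the values of a finitely supported function. -/
noncomputable def coeffSum : (M →₀ R) →+ R := Finsupp.liftAddHom fun _ => AddMonoidHom.id R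

theorem coeffSum_twist_of_not_idempotent {m : M} (hm : ¬ IsIdempotentElem m) (v : M →₀ R) :
    coeffSum (twist m v) = -coeffSum v := by
  simp only [twist, hm, if_false, AddMonoidHom.neg_apply, map_neg, coeffSum,
    Finsupp.mapDomain.addMonoidHom_apply, Finsupp.liftAddHom_apply]
  rw [Finsupp.sum_mapDomain_index] <;> simp

open Classical in
/-- The value `0` on idempotents and `1` elsewhere. -/
noncomputable def parity (R : Type*) [CommRing R] (m : M) : R :=
  if IsIdempotentElem m then 0 else 1

theorem parity_congr {m n : M} (h : IsIdempotentElem m ↔ IsIdempotentElem n) :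
    parity R m = parity R n := by
  classical
  simp only [parity, h]

theorem parity_of_idempotent {m : M} (hm : IsIdempotentElem m) : parity R m = 0 := if_pos hm

theorem parity_of_not_idempotent {m : M} (hm : ¬ IsIdempotentElem m) : parity R m = 1 := if_neg hm

theorem isIdempotentElem_iff_of_parity_eq [Nontrivial R] {m n : M}
    (h : parity R m = parity R n) : IsIdempotentElem m ↔ IsIdempotentElem n := by
  by_cases hm : IsIdempotentElem m <;> by_cases hn : IsIdempotentElem n <;>
    simp_all [parity]

/-- A function `v` labels `m` if it is supported on non-idempotent elements `y` with
`m m⁻¹ ≤ y y⁻¹`, and the sum of its values is the parity of `m`. -/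
structure Labels (m : M) (v : M →₀ R) : Prop where
  coeffSum_eq : coeffSum v = parity R m
  not_idempotent : ∀ y, v y ≠ 0 → ¬ IsIdempotentElem y
  mul_inv_mul : ∀ y, v y ≠ 0 → y * y⁻¹ * m = m

theorem labels_zero {m : M} (hm : IsIdempotentElem m) : Labels m (0 : M →₀ R) :=
  ⟨by rw [map_zero, parity_of_idempotent hm], by simp, by simp⟩

theorem labels_single {m : M} (hm : ¬ IsIdempotentElem m) :
    Labels m (Finsupp.single m (1 : R)) := by
  classical
  refine ⟨by simp [coeffSum, parity_of_not_idempotent hm], fun y hy => ?_, fun y hy => ?_⟩ <;>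
  · obtain rfl : m = y := by
      by_contra hne
      exact hy (Finsupp.single_eq_of_ne (Ne.symm hne))
    first
    | exact hm
    | exact mul_inv_mul_self m

theorem isIdempotentElem_of_labels_zero [Nontrivial R] {m : M} (h : Labels m (0 : M →₀ R)) :
    IsIdempotentElem m := by
  by_contra hm
  have := h.coeffSum_eq
  rw [map_zero, parity_of_not_idempotent hm] at this
  exact zero_ne_one this

/-- The elements of `M` together with a label. -/
@[ext]
structure LabelledCover (M : Type*) [InverseMonoid M] (R : Type*) [CommRing R] where
  elem : M
  label : M →₀ R
  labels : Labels elem label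

/-- The coefficient sum recovers the parity because `0 ≠ 1`; hence the action of an element depends
only on its label. -/
theorem LabelledCover.elem_idempotent_iff_of_label_eq [Nontrivial R] {x y : LabelledCover M R} (h : x.label = y.label) :
    IsIdempotentElem x.elem ↔ IsIdempotentElem y.elem :=
  isIdempotentElem_iff_of_parity_eq (R := R) <| by
    rw [← x.labels.coeffSum_eq, ← y.labels.coeffSum_eq, h]

end Labels

/-- The idempotents of `M` form a class of a congruence of index at most two. -/
class HasIdempotentParity (M : Type*) [InverseMonoid M] : Prop where
  isIdempotentElem_mul_iff : ∀ a b : M,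
    IsIdempotentElem (a * b) ↔ (IsIdempotentElem a ↔ IsIdempotentElem b)

open HasIdempotentParity

theorem hasIdempotentParity_of_card_le_two {M : Type*} [InverseMonoid M] (hM : IsEUnitary M)
    (hcard : ENat.card (GroupImage M) ≤ 2) : HasIdempotentParity M := by
  have key : ∀ a : M, IsIdempotentElem a ↔ (a : GroupImage M) = 1 := fun a =>
    (sigma_rel_one_iff hM).symm.trans (Con.eq (sigma M)).symm
  refine ⟨fun a b => ?_⟩
  rw [key, key, key, Con.coe_mul]
  generalize (a : GroupImage M) = x
  generalize (b : GroupImage M) = y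
  constructor
  · intro h
    constructor <;> rintro rfl <;> simpa using h
  · intro h
    by_contra hxy
    have hx : x ≠ 1 := by
      rintro rfl
      exact hxy (by simpa using h)
    have hy : y ≠ 1 := mt h.2 hx
    -- If `x`, `y` and `x y` all differ from 1, then `1, x, x y` are three distinct elements.
    have hinj : Function.Injective ![1, x, x * y] := by
      intro i j hij
      fin_cases i <;> fin_cases j <;> simp_all [eq_comm]
    have h3 := (ENat.card_le_card_of_injective hinj).trans hcard
    simp at h3
    exact absurd h3 (by decide)

/-! ### Closure of labels under the operations, and greatest carriers. -/

section Parity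

variable {M : Type*} [InverseMonoid M] [HasIdempotentParity M] {R : Type*} [CommRing R]

theorem isIdempotentElem_inv_iff (a : M) : IsIdempotentElem a⁻¹ ↔ IsIdempotentElem a := by
  have := (isIdempotentElem_mul_iff a a⁻¹).1 (isIdempotentElem_mul_inv a)
  exact this.symm

/-- Here `m z` is idempotent, so it commutes with `z⁻¹ z`, which is then absorbed by `z`. This is
why the action of a non-idempotent must invert the argument of a label. -/
theorem inv_mul_inv_mul_cancel_of_not_idempotent {z m n : M} (hz : ¬ IsIdempotentElem z)
    (hm : ¬ IsIdempotentElem m) (hn : z * z⁻¹ * n = n) :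
    z⁻¹ * z * (m * n) = m * n := by
  have hmz : IsIdempotentElem (m * z) := (isIdempotentElem_mul_iff m z).2 (by tauto)
  calc z⁻¹ * z * (m * n) = z⁻¹ * z * (m * z) * (z⁻¹ * n) := by
        conv_lhs => rw [← hn]
        simp only [mul_assoc]
    _ = m * (z * z⁻¹ * z) * (z⁻¹ * n) := by
        rw [isIdempotentElem_mul_comm (isIdempotentElem_inv_mul z) hmz]
        simp only [mul_assoc]
    _ = m * (z * z⁻¹ * n) := by rw [mul_inv_mul_self]; simp only [mul_assoc]
    _ = m * n := by rw [hn]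

theorem inv_mul_mul_inv_cancel_of_not_idempotent {z m : M} (hz : ¬ IsIdempotentElem z)
    (hm : ¬ IsIdempotentElem m) (h : z * z⁻¹ * m = m) : z⁻¹ * z * m⁻¹ = m⁻¹ := by
  have hm' : ¬ IsIdempotentElem m⁻¹ := by rwa [isIdempotentElem_inv_iff]
  have := inv_mul_inv_mul_cancel_of_not_idempotent (n := m * m⁻¹) hz hm' (by
    rw [← mul_assoc, h])
  rwa [← mul_assoc m⁻¹, inv_mul_mul_inv] at this

theorem twist_mul (m n : M) (v : M →₀ R) : twist (m * n) v = twist m (twist n v) := by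
  have h := isIdempotentElem_mul_iff m n
  by_cases hm : IsIdempotentElem m <;> by_cases hn : IsIdempotentElem n
  · rw [twist_of_idempotent (h.2 (by tauto)), twist_of_idempotent hm, twist_of_idempotent hn]
  · ext y
    rw [twist_of_idempotent hm, twist_apply_of_not_idempotent hn,
      twist_apply_of_not_idempotent (by tauto)]
  · ext y
    rw [twist_of_idempotent hn, twist_apply_of_not_idempotent hm,
      twist_apply_of_not_idempotent (by tauto)]
  · ext y
    rw [twist_of_idempotent (h.2 (by tauto)), twist_apply_of_not_idempotent hm,
      twist_apply_of_not_idempotent hn, inv_inv_eq, neg_neg]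

theorem twist_inv (m : M) (v : M →₀ R) : twist m⁻¹ v = twist m v := by
  rw [twist_congr (isIdempotentElem_inv_iff m)]

theorem twist_twist (m : M) (v : M →₀ R) : twist m (twist m v) = v := by
  conv_lhs => rw [← twist_inv m (twist m v)]
  rw [← twist_mul, twist_of_idempotent (isIdempotentElem_inv_mul m)]

/-- The sign in the action makes the sums of two non-idempotent factors cancel, `1 - 1 = 0`. An
idempotent `m` commutes with `y y⁻¹`; a non-idempotent one exchanges `y y⁻¹` for `y⁻¹ y`. -/
theorem Labels.mul {m n : M} {v w : M →₀ R} (hv : Labels m v) (hw : Labels n w) :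
    Labels (m * n) (v + twist m w) := by
  have h := isIdempotentElem_mul_iff m n
  have hl : ∀ y, v y ≠ 0 → y * y⁻¹ * (m * n) = m * n := fun y hy => by
    rw [← mul_assoc, hv.mul_inv_mul y hy]
  by_cases hm : IsIdempotentElem m
  · rw [twist_of_idempotent hm]
    have key : ∀ y, (v + w) y ≠ 0 → v y ≠ 0 ∨ w y ≠ 0 := fun y hy => by
      by_contra! hc
      exact hy (by simp [hc.1, hc.2])
    refine ⟨?_, fun y hy => ?_, fun y hy => ?_⟩
    · rw [map_add, hv.coeffSum_eq, hw.coeffSum_eq, parity_of_idempotent hm, zero_add]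
      exact parity_congr (by tauto)
    · exact (key y hy).elim (hv.not_idempotent y) (hw.not_idempotent y)
    · refine (key y hy).elim (hl y) fun hy => ?_
      rw [← mul_assoc, isIdempotentElem_mul_comm (isIdempotentElem_mul_inv y) hm, mul_assoc,
        hw.mul_inv_mul y hy]
  · have key : ∀ y, (v + twist m w) y ≠ 0 → v y ≠ 0 ∨ w y⁻¹ ≠ 0 := fun y hy => by
      by_contra! hc
      exact hy (by simp [hc.1, hc.2, twist_apply_of_not_idempotent hm])
    refine ⟨?_, fun y hy => ?_, fun y hy => ?_⟩
    · rw [map_add, coeffSum_twist_of_not_idempotent hm, hv.coeffSum_eq, hw.coeffSum_eq,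
        parity_of_not_idempotent hm]
      by_cases hn : IsIdempotentElem n
      · rw [parity_of_idempotent hn, parity_of_not_idempotent (by tauto), neg_zero, add_zero]
      · rw [parity_of_not_idempotent hn, parity_of_idempotent (by tauto), add_neg_cancel]
    · refine (key y hy).elim (hv.not_idempotent y) fun hy => ?_
      have := hw.not_idempotent _ hy
      rwa [isIdempotentElem_inv_iff] at this
    · refine (key y hy).elim (hl y) fun hy => ?_
      have := inv_mul_inv_mul_cancel_of_not_idempotent (hw.not_idempotent _ hy) hm
        (hw.mul_inv_mul _ hy)
      rwa [inv_inv_eq] at this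

theorem Labels.inv {m : M} {v : M →₀ R} (hv : Labels m v) : Labels m⁻¹ (-twist m v) := by
  by_cases hm : IsIdempotentElem m
  · rw [twist_of_idempotent hm, inv_eq_self_of_isIdempotentElem hm]
    refine ⟨?_, fun y hy => hv.not_idempotent y (by simpa using hy),
      fun y hy => hv.mul_inv_mul y (by simpa using hy)⟩
    rw [map_neg, hv.coeffSum_eq, parity_of_idempotent hm, neg_zero]
  · have hm' : ¬ IsIdempotentElem m⁻¹ := by rwa [isIdempotentElem_inv_iff]
    have key : ∀ y, (-twist m v) y ≠ 0 → v y⁻¹ ≠ 0 := fun y hy => by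
      simpa [twist_apply_of_not_idempotent hm] using hy
    refine ⟨?_, fun y hy => ?_, fun y hy => ?_⟩
    · rw [map_neg, coeffSum_twist_of_not_idempotent hm, neg_neg, hv.coeffSum_eq,
        parity_of_not_idempotent hm, parity_of_not_idempotent hm']
    · have := hv.not_idempotent _ (key y hy)
      rwa [isIdempotentElem_inv_iff] at this
    · have := inv_mul_mul_inv_cancel_of_not_idempotent (hv.not_idempotent _ (key y hy)) hm
        (hv.mul_inv_mul _ (key y hy))
      rwa [inv_inv_eq] at this

/-- Among the elements with a given label there is a greatest one. -/
theorem Labels.exists_greatest [Nontrivial R] {m : M} {v : M →₀ R} (hv : Labels m v) :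
    ∃ k : M, Labels k v ∧ ∀ n : M, Labels n v → NatLE n k := by
  obtain ⟨e, he, h1, h2⟩ := exists_idempotent_forall_mul_inv_mul v.support
  simp only [Finsupp.mem_support_iff] at h1 h2
  have hpar : ∀ n : M, Labels n v → (IsIdempotentElem n ↔ IsIdempotentElem m) := fun n hn =>
    isIdempotentElem_iff_of_parity_eq (R := R) (hn.coeffSum_eq.symm.trans hv.coeffSum_eq)
  by_cases hm : IsIdempotentElem m
  · refine ⟨e, ⟨?_, hv.not_idempotent, h1⟩, fun n hn => ⟨n, (hpar n hn).2 hm, ?_⟩⟩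
    · rw [hv.coeffSum_eq, parity_of_idempotent hm, parity_of_idempotent he]
    · rw [isIdempotentElem_mul_comm ((hpar n hn).2 hm) he, h2 n hn.mul_inv_mul]
  -- The coefficient sum is `1 ≠ 0`, so the support contains some `z`. For any carrier `n`, `z⁻¹ n`
  -- is idempotent, so `n = z (z⁻¹ n)` lies below `z`, and restricting by `e` gives `n ≤ e z`.
  · obtain ⟨z, hz⟩ : ∃ z, v z ≠ 0 := by
      by_contra! hc
      obtain rfl : v = 0 := Finsupp.ext hc
      exact hm (isIdempotentElem_of_labels_zero hv)
    have hzi := hv.not_idempotent z hz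
    have hez : ¬ IsIdempotentElem (e * z) := by
      rw [isIdempotentElem_mul_iff]
      tauto
    refine ⟨e * z, ⟨?_, hv.not_idempotent, fun y hy => by rw [← mul_assoc, h1 y hy]⟩,
      fun n hn => ?_⟩
    · rw [hv.coeffSum_eq, parity_of_not_idempotent hm, parity_of_not_idempotent hez]
    · have hni : ¬ IsIdempotentElem n := mt (hpar n hn).1 hm
      have hf : IsIdempotentElem (z⁻¹ * n) := by
        rw [isIdempotentElem_mul_iff, isIdempotentElem_inv_iff]
        tauto
      refine ⟨z * (z⁻¹ * n) * z⁻¹, isIdempotentElem_conj z hf, ?_⟩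
      calc n = e * (z * z⁻¹ * n) := by rw [hn.mul_inv_mul z hz, h2 n hn.mul_inv_mul]
        _ = e * (z * (z⁻¹ * n) * z⁻¹ * z) := by
          rw [← mul_idempotent_eq z hf, mul_assoc z]
        _ = e * (z * (z⁻¹ * n) * z⁻¹) * z := by simp only [mul_assoc]
        _ = z * (z⁻¹ * n) * z⁻¹ * (e * z) := by
          rw [isIdempotentElem_mul_comm he (isIdempotentElem_conj z hf)]
          simp only [mul_assoc]

/-! ### The labelled cover and its kernel. -/

namespace LabelledCover

noncomputable instance : InverseMonoid (LabelledCover M R) where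
  mul x y := ⟨x.elem * y.elem, x.label + twist x.elem y.label, x.labels.mul y.labels⟩
  one := ⟨1, 0, labels_zero .one⟩
  inv x := ⟨x.elem⁻¹, -twist x.elem x.label, x.labels.inv⟩
  mul_assoc x y z := by
    refine LabelledCover.ext (mul_assoc _ _ _) ?_
    show x.label + twist x.elem y.label + twist (x.elem * y.elem) z.label =
      x.label + twist x.elem (y.label + twist y.elem z.label)
    rw [map_add, twist_mul, add_assoc]
  one_mul x := by
    refine LabelledCover.ext (one_mul _) ?_
    show 0 + twist 1 x.label = x.label
    rw [zero_add, twist_of_idempotent .one]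
  mul_one x := by
    refine LabelledCover.ext (mul_one _) ?_
    show x.label + twist x.elem 0 = x.label
    rw [map_zero, add_zero]
  mul_inv_mul_self x := by
    refine LabelledCover.ext (mul_inv_mul_self x.elem) ?_
    show x.label + twist x.elem (-twist x.elem x.label) + twist (x.elem * x.elem⁻¹) x.label =
      x.label
    rw [map_neg, twist_twist, twist_of_idempotent (isIdempotentElem_mul_inv _), add_neg_cancel,
      zero_add]
  inv_mul_mul_inv x := by
    refine LabelledCover.ext (inv_mul_mul_inv x.elem) ?_
    show -twist x.elem x.label + twist x.elem⁻¹ x.label +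
      twist (x.elem⁻¹ * x.elem) (-twist x.elem x.label) = -twist x.elem x.label
    rw [twist_inv, twist_of_idempotent (isIdempotentElem_inv_mul _), neg_add_cancel, zero_add]
  inv_unique x y hxy hyx := by
    have h := inv_unique x.elem y.elem (congrArg elem hxy) (congrArg elem hyx)
    refine LabelledCover.ext h ?_
    have hl : x.label + twist x.elem y.label + twist (x.elem * y.elem) x.label = x.label :=
      congrArg label hxy
    rw [h, twist_of_idempotent (isIdempotentElem_mul_inv _), add_eq_right] at hl
    show y.label = -twist x.elem x.label
    rw [← twist_twist x.elem y.label, ← map_neg, eq_neg_of_add_eq_zero_right hl]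

theorem label_mul (x y : LabelledCover M R) :
    (x * y).label = x.label + twist x.elem y.label := rfl

/-- The projection of the labelled cover to `M`. -/
def proj (M : Type*) [InverseMonoid M] [HasIdempotentParity M] (R : Type*) [CommRing R] :
    LabelledCover M R →* M where
  toFun := elem
  map_one' := rfl
  map_mul' _ _ := rfl

theorem proj_surjective : Function.Surjective (proj M R) := by
  intro m
  by_cases hm : IsIdempotentElem m
  · exact ⟨⟨m, 0, labels_zero hm⟩, rfl⟩
  · exact ⟨⟨m, _, labels_single hm⟩, rfl⟩

theorem label_eq_zero_of_idempotent {x : LabelledCover M R} (hx : IsIdempotentElem x) :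
    x.label = 0 := by
  have h1 : IsIdempotentElem x.elem := congrArg elem hx.eq
  have h2 : x.label + twist x.elem x.label = x.label := congrArg label hx.eq
  rwa [twist_of_idempotent h1, add_eq_left] at h2

theorem idempotent_of_elem_idempotent {x : LabelledCover M R} (hx : IsIdempotentElem x.elem)
    (h0 : x.label = 0) : IsIdempotentElem x :=
  LabelledCover.ext hx.eq (by rw [label_mul, h0, map_zero, add_zero])

theorem natLE_of_label_eq {x y : LabelledCover M R} (hl : x.label = y.label)
    (h : NatLE x.elem y.elem) : NatLE x y := by
  obtain ⟨e, he, hxy⟩ := h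
  refine ⟨⟨e, 0, labels_zero he⟩, idempotent_of_elem_idempotent he rfl,
    LabelledCover.ext hxy ?_⟩
  show x.label = 0 + twist e y.label
  rw [twist_of_idempotent he, zero_add, hl]

variable [Nontrivial R]

/-- The congruence identifying elements with equal labels. -/
def labelCon (M : Type*) [InverseMonoid M] [HasIdempotentParity M] (R : Type*) [CommRing R]
    [Nontrivial R] : Con (LabelledCover M R) where
  r x y := x.label = y.label
  iseqv := ⟨fun _ => rfl, Eq.symm, Eq.trans⟩
  mul' := by
    intro x x' y y' hx hy
    show x.label + twist x.elem y.label = x'.label + twist x'.elem y'.label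
    rw [hx, hy, twist_congr (elem_idempotent_iff_of_label_eq hx)]

theorem exists_greatest (x : LabelledCover M R) :
    ∃ k : LabelledCover M R, k.label = x.label ∧
      ∀ y : LabelledCover M R, y.label = x.label → NatLE y k := by
  obtain ⟨k, hk, h⟩ := x.labels.exists_greatest
  exact ⟨⟨k, x.label, hk⟩, rfl, fun y hy => natLE_of_label_eq hy (h _ (hy ▸ y.labels))⟩

/-- Idempotents have label 0, so equality of labels is a group congruence and contains `σ`.
Conversely, elements with equal labels lie below a common greatest one. -/
theorem sigma_iff {x y : LabelledCover M R} :
    sigma (LabelledCover M R) x y ↔ x.label = y.label := by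
  constructor
  · intro h
    refine h (labelCon M R) (isGroupCon_of_rel_one fun e he => ?_)
    exact label_eq_zero_of_idempotent he
  · intro h
    obtain ⟨k, -, hk⟩ := exists_greatest y
    exact (sigma _).trans (sigma_of_natLE (hk x h)) ((sigma _).symm (sigma_of_natLE (hk y rfl)))

theorem isFInverseCover_proj : IsFInverseCover (proj M R) where
  fInverse x := by
    obtain ⟨k, hk, h⟩ := exists_greatest x
    exact ⟨k, sigma_iff.2 hk, fun y hy => h y (sigma_iff.1 hy)⟩
  surjective := proj_surjective
  idempotentSeparating x hx y hy h := LabelledCover.ext h <| by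
    rw [label_eq_zero_of_idempotent hx, label_eq_zero_of_idempotent hy]

/-- The label of a `σ`-class. -/
noncomputable def classLabel : GroupImage (LabelledCover M R) → (M →₀ R) :=
  Quotient.lift label fun _ _ h => sigma_iff.1 h

theorem classLabel_injective :
    Function.Injective (classLabel : GroupImage (LabelledCover M R) → (M →₀ R)) := by
  intro a b
  induction a using Con.induction_on with
  | H x =>
    induction b using Con.induction_on with
    | H y => exact fun h => (Con.eq _).2 (sigma_iff.2 h)

/-- Labels multiply as a crossed homomorphism; over the kernel, `E`-unitarity makes the
`M`-component idempotent, so the twist disappears. -/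
theorem classLabel_mul (hM : IsEUnitary M) {a b : GroupImage (LabelledCover M R)}
    (ha : groupImageMap (proj M R) a = 1) :
    classLabel (a * b) = classLabel a + classLabel b := by
  induction a using Con.induction_on with
  | H x =>
    induction b using Con.induction_on with
    | H y =>
      have hx : IsIdempotentElem x.elem :=
        (sigma_rel_one_iff hM).1 ((Con.eq (sigma M)).1 ha)
      show x.label + twist x.elem y.label = x.label + y.label
      rw [twist_of_idempotent hx]

/-- The embedding of the kernel of the induced group homomorphism into the group of labels. -/
noncomputable def kerLabel (hM : IsEUnitary M) :
    (groupImageMap (proj M R)).ker →* Multiplicative (M →₀ R) :=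
  MonoidHom.mk' (fun a => Multiplicative.ofAdd (classLabel a.1)) fun a _ =>
    congrArg Multiplicative.ofAdd (classLabel_mul hM a.2)

theorem kerLabel_injective (hM : IsEUnitary M) :
    Function.Injective (kerLabel (R := R) hM) := fun _ _ h =>
  Subtype.ext (classLabel_injective (Multiplicative.ofAdd.injective h))

end LabelledCover

end Parity

end InverseMonoid

/-! ### Group varieties and prime cyclic groups. -/

namespace GroupVariety

variable {U : GroupVariety}

theorem Mem.of_jointly_injective {ι : Type*} {N : Type*} [Group N] {P : Type*} [Group P]
    (hP : U.Mem P) (φ : ι → N →* P) (hφ : ∀ a : N, (∀ i, φ i a = 1) → a = 1) : U.Mem N := by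
  intro w hw f
  refine hφ _ fun i => ?_
  rw [← hP w hw (φ i ∘ f), ← MonoidHom.comp_apply]
  congr 1
  ext n
  simp

theorem Mem.of_injective {N : Type*} [Group N] {P : Type*} [Group P] (hP : U.Mem P)
    (φ : N →* P) (hφ : Function.Injective φ) : U.Mem N :=
  hP.of_jointly_injective (fun _ : Unit => φ) fun _ h =>
    (injective_iff_map_eq_one φ).1 hφ _ (h ())

theorem Mem.finsupp {R α : Type*} [AddCommGroup R] (hR : U.Mem (Multiplicative R)) :
    U.Mem (Multiplicative (α →₀ R)) :=
  hR.of_jointly_injective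
    (fun i : α => AddMonoidHom.toMultiplicative (Finsupp.applyAddHom i)) fun _ h =>
      Multiplicative.toAdd.injective (Finsupp.ext fun i => Multiplicative.ofAdd.injective (h i))

/-- A non-trivial group variety contains a cyclic group of prime order. -/
theorem IsNontrivial.exists_prime_mem (hU : GroupVariety.IsNontrivial.{v} U) :
    ∃ p : ℕ, p.Prime ∧ U.Mem (Multiplicative (ZMod p)) := by
  obtain ⟨N, _, _, hN⟩ := hU
  obtain ⟨a, ha⟩ := exists_ne (1 : N)
  -- If `a` has infinite order, `orderOf a = 0` and `minFac` returns 2, still a valid choice.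
  -- Lifting the assignment to integer exponents, the law in `⟨a⟩` forces the resulting exponent to
  -- be divisible by `orderOf a`, hence by this prime.
  refine ⟨(orderOf a).minFac, Nat.minFac_prime (by simpa using ha), fun w hw f => ?_⟩
  choose g hg using fun i => ZMod.intCast_surjective (f i).toAdd
  set g' : ℕ → Multiplicative ℤ := fun i => Multiplicative.ofAdd (g i)
  have h1 : zpowersHom N a (FreeGroup.lift g' w) = 1 := by
    rw [← hN w hw (zpowersHom N a ∘ g'), ← MonoidHom.comp_apply]
    congr 1
    ext n
    simp
  have h2 : (Int.castAddHom (ZMod (orderOf a).minFac)).toMultiplicative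
      (FreeGroup.lift g' w) =
      FreeGroup.lift f w := by
    rw [← MonoidHom.comp_apply]
    congr 1
    ext n
    simp [g', hg]
  rw [← h2]
  rw [zpowersHom_apply] at h1
  have h3 : ((orderOf a).minFac : ℤ) ∣ (FreeGroup.lift g' w).toAdd :=
    (Int.natCast_dvd_natCast.2 (Nat.minFac_dvd _)).trans (orderOf_dvd_iff_zpow_eq_one.2 h1)
  exact congrArg Multiplicative.ofAdd ((ZMod.intCast_zmod_eq_zero_iff_dvd _ _).2 h3)

end GroupVariety

theorem isElementaryAbelianGroup_of_injective {p : ℕ} {α N : Type*} [Group N]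
    (φ : N →* Multiplicative (α →₀ ZMod p)) (hφ : Function.Injective φ) :
    IsElementaryAbelianGroup p N := by
  refine ⟨fun a b => hφ (by rw [map_mul, map_mul, mul_comm]), fun a => hφ ?_⟩
  rw [map_pow, map_one]
  refine Multiplicative.toAdd.injective (Finsupp.ext fun i => ?_)
  simp

theorem proposition4 (M : Type u) [InverseMonoid M]
    (hfin : InverseMonoid.IsFiniteAbove M) (hunit : InverseMonoid.IsEUnitary M)
    (hcard : ENat.card (InverseMonoid.GroupImage M) ≤ 2) :
    (∀ U : GroupVariety, GroupVariety.IsNontrivial.{v} U →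
      InverseMonoid.HasFInverseCoverVia M (fun N [Group N] => U.Mem N)) ∧
    (∀ p : ℕ, p.Prime →
      InverseMonoid.HasFInverseCoverVia M (fun N [Group N] => IsElementaryAbelianGroup p N)) := by
  have := InverseMonoid.hasIdempotentParity_of_card_le_two hunit hcard
  constructor
  · intro U hU
    obtain ⟨p, hp, hUp⟩ := hU.exists_prime_mem
    have := Fact.mk hp
    exact ⟨InverseMonoid.LabelledCover M (ZMod p), inferInstance, _,
      InverseMonoid.LabelledCover.isFInverseCover_proj,
      hUp.finsupp.of_injective _ (InverseMonoid.LabelledCover.kerLabel_injective hunit)⟩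
  · intro p hp
    have := Fact.mk hp
    exact ⟨InverseMonoid.LabelledCover M (ZMod p), inferInstance, _,
      InverseMonoid.LabelledCover.isFInverseCover_proj,
      isElementaryAbelianGroup_of_injective _
        (InverseMonoid.LabelledCover.kerLabel_injective hunit)⟩
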